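/- Let $\Gamma_1$ be a triangle with an upmost, a leftmost and a rightmost vertex, whose edges leftmost–upmost, leftmost–rightmost and upmost–rightmost are labelled $a$, $b$ and $c$ respectively. For $n\ge 1$ let $\Gamma_{n+1}$ be the labelled graph obtained by placing a copy of $\Gamma_n$ at each of the three corners of an equilateral triangle of twice the side length, the copy at a given corner being reflected in the bisectrix of the angle at that corner; vertices of the copies at the same position are identified, and labels are kept. The outmost vertices of $\Gamma_{n+1}$ are the three corners of the big triangle. (These are the Sierpiński graphs with the ``Schreier'' labelling.) Give each edge its label $a$, $b$ or $c$ as its weight, and let the weight of a subgraph be the product of the weights of its edges. A spanning $k$-forest of a graph is an acyclic subgraph with exactly $k$ connected components that contains all the vertices; a spanning tree is a spanning $1$-forest. For $n\ge 1$ let - $T_n(a,b,c)$ be the sum of the weights of the spanning trees of $\Gamma_n$; - $U_n(a,b,c)$ be the sum of the weights of the spanning $2$-forests of $\Gamma_n$ in which the leftmost and the rightmost vertices are in the same component and the upmost vertex is in the other one; and let $R_n(a,b,c)$ (respectively $L_n(a,b,c)$) be the analogous sum for the spanning $2$-forests in which the rightmost (respectively leftmost) vertex is not in the component containing the other two outmost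 vertices; - $Q_n(a,b,c)$ be the sum of the weights of the spanning $3$-forests of $\Gamma_n$ in which the three outmost vertices are in three different components. Then, as identities between polynomials in $a,b,c$ (equivalently, for all elements $a,b,c$ of any commutative semiring), for each $n\ge 1$ $$T_{n+1}=2T_n^2(U_n+R_n+L_n),$$ $$U_{n+1}=T_n\left(3L_nR_n+U_nR_n+U_nL_n+2U_n^2\right)+T_n^2Q_n,$$ $$R_{n+1}=T_n\left(3U_nL_n+U_nR_n+R_nL_n+2R_n^2\right)+T_n^2Q_n,$$ $$L_{n+1}=T_n\left(3U_nR_n+L_nU_n+R_nL_n+2L_n^2\right)+T_n^2Q_n,$$ $$Q_{n+1}=4T_nQ_n(U_n+R_n+L_n)+2\left(U_n^2(L_n+R_n)+R_n^2(U_n+L_n)+L_n^2(R_n+U_n)\right)+2U_nR_nL_n,$$ with initial values $$T_1=ab+ac+bc,\qquad U_1=b,\qquad R_1=a,\qquad L_1=c,\qquad Q_1=1.$$ -/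

import Mathlib

/-- The three edge labels. -/
inductive Label
  | a | b | c
  deriving DecidableEq

instance : Fintype Label where
  elems := {.a, .b, .c}
  complete x := by cases x <;> simp

/-- The three outmost (corner) positions of an equilateral triangle:
upmost, leftmost, rightmost. -/
inductive Corner
  | up | left | right
  deriving DecidableEq

instance : Fintype Corner where
  elems := {.up, .left, .right}
  complete x := by cases x <;> simp

/-- The symmetry of the triangle given by the reflection in the bisectrix of the angle at the
corner `k`: it fixes `k` and exchanges the other two corners. -/
def Corner.reflect : Corner → Corner → Corner
  | .up, .up => .up
  | .up, .left => .right
  | .up, .right => .left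
  | .left, .left => .left
  | .left, .up => .right
  | .left, .right => .up
  | .right, .right => .right
  | .right, .up => .left
  | .right, .left => .up

/-- Points of the triangular lattice. `x : Point` with coordinate sum `N` is the point
with barycentric coordinates `x k / N` in the equilateral triangle of side length `N`; thus the
corner `k` of that triangle has `k`-th coordinate `N` and the other coordinates `0`. -/
abbrev Point := Corner → ℕ

/-- The corner `k` of the triangle of side length `N`. -/
def cornerPoint (N : ℕ) (k : Corner) : Point := Pi.single k N

/-- The isometry which takes the triangle of side length `N`, reflects it in the bisectrix
of its angle at the corner `k`, and moves it to the corner `k` of the triangle of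
side length `2 * N`. -/
def placeCopy (N : ℕ) (k : Corner) (x : Point) : Point :=
  fun i => x (k.reflect i) + cornerPoint N k i

/-- A finite graph drawn on lattice points in an equilateral triangle of side length `side`,
with edges labelled by `a`, `b`, `c` and with three distinguished outmost vertices.
(Multiple edges are not excluded by the type.) -/
structure TriangleGraph where
  side : ℕ
  verts : Set Point
  Edge : Type
  fintypeEdge : Fintype Edge
  ends : Edge → Sym2 verts
  label : Edge → Label
  outmost : Corner → verts

namespace TriangleGraph

attribute [instance] fintypeEdge

/-- The elementary triangle: the left side is labelled `a`, the horizontal side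
is labelled `b` and the right side is labelled `c`. -/
def triangle : TriangleGraph where
  side := 1
  verts := Set.range (cornerPoint 1)
  Edge := Label
  fintypeEdge := inferInstance
  ends
    | .a => s(⟨cornerPoint 1 .left, ⟨_, rfl⟩⟩, ⟨cornerPoint 1 .up, ⟨_, rfl⟩⟩)
    | .b => s(⟨cornerPoint 1 .left, ⟨_, rfl⟩⟩, ⟨cornerPoint 1 .right, ⟨_, rfl⟩⟩)
    | .c => s(⟨cornerPoint 1 .up, ⟨_, rfl⟩⟩, ⟨cornerPoint 1 .right, ⟨_, rfl⟩⟩)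
  label := id
  outmost k := ⟨cornerPoint 1 k, ⟨k, rfl⟩⟩

variable (G : TriangleGraph)

/-- The vertices of the union of the three reflected copies of `G`. -/
def gluedVerts : Set Point := ⋃ k, placeCopy G.side k '' G.verts

/-- The inclusion of the vertices of the reflected copy of `G` placed at the corner `k`. -/
def copyVert (k : Corner) (x : G.verts) : G.gluedVerts :=
  ⟨placeCopy G.side k x, Set.mem_iUnion.2 ⟨k, x, x.2, rfl⟩⟩

/-- The union of three copies of `G` inside a triangle of double side length, the copy at each
corner being reflected in the bisectrix of the angle at that corner. Vertices at
the same position are identified, labels are kept. -/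
def glue : TriangleGraph where
  side := 2 * G.side
  verts := G.gluedVerts
  Edge := Corner × G.Edge
  fintypeEdge := inferInstance
  ends e := (G.ends e.2).map (G.copyVert e.1)
  label e := G.label e.2
  outmost k := G.copyVert k (G.outmost k)

variable {G}

/-- The spanning subgraph of `G` with edge set `F`. -/
def spanning (F : Finset G.Edge) : SimpleGraph G.verts :=
  SimpleGraph.fromEdgeSet (G.ends '' F)

/-- `F` is the edge set of a spanning `k`-forest of `G`: the spanning subgraph with edge
set `F` has no cycle (hence no loop and no pair of parallel edges) and exactly
`k` connected components. A spanning tree is a spanning `1`-forest. -/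
def IsSpanningForest (k : ℕ) (F : Finset G.Edge) : Prop :=
  (∀ e ∈ F, ¬ (G.ends e).IsDiag) ∧ Set.InjOn G.ends F ∧ (spanning F).IsAcyclic ∧
    Nat.card (spanning F).ConnectedComponent = k

/-- The outmost vertices `i` and `j` lie in the same connected component of the
spanning subgraph with edge set `F`. -/
def Joined (F : Finset G.Edge) (i j : Corner) : Prop :=
  (spanning F).Reachable (G.outmost i) (G.outmost j)

variable {R : Type*} [CommSemiring R]

/-- The weight of a set of edges: the product of the weights of the labels of its edges. -/
def weight (w : Label → R) (F : Finset G.Edge) : R := ∏ e ∈ F, w (G.label e)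

variable (G)

open Classical in
/-- The weighted generating function of the edge sets satisfying `P`. -/
noncomputable def genFun (w : Label → R) (P : Finset G.Edge → Prop) : R :=
  ∑ F : Finset G.Edge with P F, weight w F

/-- Weighted generating function of the spanning trees. -/
noncomputable def treeGF (w : Label → R) : R :=
  G.genFun w fun F => IsSpanningForest 1 F

/-- Weighted generating function of the spanning `2`-forests in which the outmost vertex `k` is
not in the component that contains the other two outmost vertices. -/
noncomputable def twoForestGF (w : Label → R) (k : Corner) : R :=
  G.genFun w fun F => IsSpanningForest 2 F ∧
    ∀ i j, i ≠ k → j ≠ k → Joined F i j ∧ ¬ Joined F i k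

/-- Weighted generating function of the spanning `3`-forests in which the three outmost vertices
are in three different components. -/
noncomputable def threeForestGF (w : Label → R) : R :=
  G.genFun w fun F => IsSpanningForest 3 F ∧ ∀ i j, i ≠ j → ¬ Joined F i j

end TriangleGraph

/-- The Sierpiński graph `Γ_n`, `n ≥ 1`, with the Schreier labelling: `Γ_1` is the elementary
triangle, and `Γ_{n+1}` is glued from three reflected copies of `Γ_n`. -/
def schreierGraph (n : ℕ) : TriangleGraph := TriangleGraph.glue^[n - 1] TriangleGraph.triangle

section Functions

variable {R : Type*} [CommSemiring R]

/-- The weights `a`, `b`, `c` of the three labels. -/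
def labelWeight (a b c : R) : Label → R
  | .a => a
  | .b => b
  | .c => c

/-- `T_n(a,b,c)`: spanning trees of `Γ_n`. -/
noncomputable def schreierT (n : ℕ) (a b c : R) : R :=
  (schreierGraph n).treeGF (labelWeight a b c)

/-- `U_n(a,b,c)`: spanning `2`-forests of `Γ_n` with the upmost vertex separated from the component
of the leftmost and rightmost vertices. -/
noncomputable def schreierU (n : ℕ) (a b c : R) : R :=
  (schreierGraph n).twoForestGF (labelWeight a b c) .up

/-- `R_n(a,b,c)`: the same with the rightmost vertex separated. -/
noncomputable def schreierR (n : ℕ) (a b c : R) : R :=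
  (schreierGraph n).twoForestGF (labelWeight a b c) .right

/-- `L_n(a,b,c)`: the same with the leftmost vertex separated. -/
noncomputable def schreierL (n : ℕ) (a b c : R) : R :=
  (schreierGraph n).twoForestGF (labelWeight a b c) .left

/-- `Q_n(a,b,c)`: spanning `3`-forests of `Γ_n` separating the three outmost vertices. -/
noncomputable def schreierQ (n : ℕ) (a b c : R) : R :=
  (schreierGraph n).threeForestGF (labelWeight a b c)

end Functions

/-!
A spanning forest of the glued graph whose components all meet the outmost vertices splits into such
forests of the three copies. How the corners of the copies are connected depends only on the
partitions of the corners that these forests induce. Acyclicity does not have to be followed through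
the gluing: a set `F` of edges is a forest iff `|F|` plus its number of components is the number of
vertices. As the copies share three vertices, the forests glue to a forest iff their numbers of
components add up to that of the glued forest plus `3`. The recursion is thus an enumeration of the
triples of partitions of three corners.
-/

section EulerCharacteristic

open SimpleGraph

variable {V α : Type*} {G : SimpleGraph V} {u v : V}

theorem eq_of_reachable {f : V → α} (hf : ∀ x y, G.Adj x y → f x = f y) (h : G.Reachable u v) :
    f u = f v := by
  obtain ⟨p⟩ := h
  induction p with
  | nil => rfl
  | cons hadj _ ih => exact (hf _ _ hadj).trans ih

theorem card_connectedComponent_sup_edge [Finite V] (h : ¬G.Reachable u v) :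
    Nat.card (G ⊔ edge u v).ConnectedComponent + 1 = Nat.card G.ConnectedComponent := by
  classical
  have huv : u ≠ v := fun e => h (e ▸ .rfl)
  let merge (x : V) : G.ConnectedComponent :=
    if G.Reachable x u then G.connectedComponentMk v else G.connectedComponentMk x
  have merge_of_ne {x : V} (hx : G.connectedComponentMk x ≠ G.connectedComponentMk u) :
      merge x = G.connectedComponentMk x := if_neg fun hr => hx (ConnectedComponent.sound hr)
  have merge_eq (x y : V) (hxy : (G ⊔ edge u v).Adj x y) : merge x = merge y := by
    have hu : merge u = G.connectedComponentMk v := if_pos .rfl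
    have hv : merge v = G.connectedComponentMk v := if_neg fun hr => h hr.symm
    rcases hxy with hxy | hxy
    · have hr := hxy.reachable
      have : G.Reachable x u ↔ G.Reachable y u := ⟨hr.symm.trans, hr.trans⟩
      simp only [merge, this, ConnectedComponent.sound hr]
    · obtain ⟨⟨rfl, rfl⟩ | ⟨rfl, rfl⟩, -⟩ := (edge_adj u v x y).1 hxy <;> rw [hu, hv]
  let f (C : {C : G.ConnectedComponent // C ≠ G.connectedComponentMk u}) :
      (G ⊔ edge u v).ConnectedComponent := C.1.map (Hom.ofLE le_sup_left)
  have hf : Function.Bijective f := by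
    constructor
    · rintro ⟨⟨x⟩, hx⟩ ⟨⟨y⟩, hy⟩ hxy
      have hmerge : merge x = merge y := eq_of_reachable merge_eq (ConnectedComponent.exact hxy)
      rw [merge_of_ne hx, merge_of_ne hy] at hmerge
      exact Subtype.ext hmerge
    · rintro ⟨x⟩
      by_cases hx : G.Reachable x u
      · refine ⟨⟨G.connectedComponentMk v, fun e => h (ConnectedComponent.exact e).symm⟩, ?_⟩
        have hvu : (G ⊔ edge u v).Adj v u := Or.inr ((edge_adj u v v u).2 ⟨by simp, huv.symm⟩)
        exact ConnectedComponent.sound (hvu.reachable.trans (hx.symm.mono le_sup_left))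
      · exact ⟨⟨G.connectedComponentMk x, fun e => hx (ConnectedComponent.exact e)⟩, rfl⟩
  rw [← Nat.card_eq_of_bijective f hf, ← Set.ncard_add_ncard_compl {G.connectedComponentMk u},
    Set.ncard_singleton, add_comm]
  rfl

theorem card_connectedComponent_bot : Nat.card (⊥ : SimpleGraph V).ConnectedComponent =
    Nat.card V :=
  (Nat.card_eq_of_bijective (connectedComponentMk ⊥)
    ⟨fun _ _ h => reachable_bot.1 (ConnectedComponent.exact h), Quot.mk_surjective⟩).symm

theorem ncard_edgeSet_add_card_connectedComponent_of_isAcyclic [Finite V] (hG : G.IsAcyclic) :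
    G.edgeSet.ncard + Nat.card G.ConnectedComponent = Nat.card V := by
  induction hn : G.edgeSet.ncard generalizing G with
  | zero =>
    obtain rfl : G = ⊥ := edgeSet_eq_empty.1 ((Set.ncard_eq_zero).1 hn)
    rw [zero_add, card_connectedComponent_bot]
  | succ n ih =>
    obtain ⟨⟨u, v⟩, huv⟩ := Set.nonempty_of_ncard_ne_zero (hn.trans_ne n.succ_ne_zero)
    replace huv : s(u, v) ∈ G.edgeSet := huv
    have hbridge := isBridge_iff.1 (isAcyclic_iff_forall_isBridge.1 hG huv)
    have hsup : G.deleteEdges {s(u, v)} ⊔ edge u v = G := by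
      rw [deleteEdges, ← edge, sdiff_sup_cancel ((edge_le_iff ..).2 (Or.inr huv))]
    have hcard : (G.deleteEdges {s(u, v)}).edgeSet.ncard = n := by
      rw [edgeSet_deleteEdges, Set.ncard_sdiff_singleton_of_mem huv, hn, Nat.add_sub_cancel]
    have hdelete := ih (hG.anti (deleteEdges_le _)) hcard
    have hcomp := card_connectedComponent_sup_edge hbridge
    rw [hsup] at hcomp
    omega

theorem exists_isAcyclic_card_connectedComponent_eq (G : SimpleGraph V) :
    ∃ F ≤ G, F.IsAcyclic ∧ Nat.card F.ConnectedComponent = Nat.card G.ConnectedComponent := by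
  obtain ⟨F, hle, hF, hr⟩ := exists_isAcyclic_reachable_eq_le (G := G)
  exact ⟨F, hle, hF, by rw [ConnectedComponent, ConnectedComponent, hr]⟩

theorem card_le_ncard_edgeSet_add_card_connectedComponent [Finite V] (G : SimpleGraph V) :
    Nat.card V ≤ G.edgeSet.ncard + Nat.card G.ConnectedComponent := by
  obtain ⟨F, hle, hF, hcomp⟩ := exists_isAcyclic_card_connectedComponent_eq G
  rw [← ncard_edgeSet_add_card_connectedComponent_of_isAcyclic hF, hcomp]
  exact Nat.add_le_add_right (Set.ncard_le_ncard (edgeSet_mono hle)) _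

theorem isAcyclic_iff_ncard_edgeSet_add_card_connectedComponent [Finite V] :
    G.IsAcyclic ↔ G.edgeSet.ncard + Nat.card G.ConnectedComponent = Nat.card V := by
  refine ⟨ncard_edgeSet_add_card_connectedComponent_of_isAcyclic, fun hG => ?_⟩
  obtain ⟨F, hle, hF, hcomp⟩ := exists_isAcyclic_card_connectedComponent_eq G
  have hcard := ncard_edgeSet_add_card_connectedComponent_of_isAcyclic hF
  have hedges := Set.eq_of_subset_of_ncard_le (edgeSet_mono hle) (by omega)
  rwa [← edgeSet_inj.1 hedges]

end EulerCharacteristic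

theorem Corner.forall {P : Corner → Prop} : (∀ k, P k) ↔ P .up ∧ P .left ∧ P .right :=
  ⟨fun h => ⟨h _, h _, h _⟩, fun h k => by cases k <;> simp only [h]⟩

/- The enumeration of `gluings` below evaluates this instance in the kernel, where it is much faster
than the instance for arbitrary finite types. -/
instance Corner.decidableForall (P : Corner → Prop) [DecidablePred P] : Decidable (∀ k, P k) :=
  decidable_of_iff' _ Corner.forall

/-- The partitions of the set of corners; the blocks of `isolating k` are `{k}` and its
complement. -/
inductive CornerPartition
  | joined
  | isolating (k : Corner)
  | discrete
  deriving DecidableEq, Fintype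

namespace CornerPartition

/-- The relation of lying in the same block. -/
def Rel : CornerPartition → Corner → Corner → Prop
  | joined, _, _ => True
  | isolating k, i, j => i = k ↔ j = k
  | discrete, i, j => i = j

instance : ∀ p : CornerPartition, DecidableRel p.Rel
  | joined, _, _ => inferInstanceAs (Decidable True)
  | isolating k, i, j => inferInstanceAs (Decidable (i = k ↔ j = k))
  | discrete, i, j => inferInstanceAs (Decidable (i = j))

/-- The number of blocks. -/
def numBlocks : CornerPartition → ℕ
  | joined => 1
  | isolating _ => 2
  | discrete => 3

theorem rel_refl : ∀ (p : CornerPartition) (i : Corner), p.Rel i i := by decide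

theorem rel_symm : ∀ (p : CornerPartition) {i j : Corner}, p.Rel i j → p.Rel j i := by decide

theorem rel_trans :
    ∀ (p : CornerPartition) {i j k : Corner}, p.Rel i j → p.Rel j k → p.Rel i k := by
  decide

/-- A partition as an equivalence relation. -/
def setoid (p : CornerPartition) : Setoid Corner where
  r := p.Rel
  iseqv := ⟨p.rel_refl, p.rel_symm, p.rel_trans⟩

instance (p : CornerPartition) : DecidableRel p.setoid := inferInstanceAs (DecidableRel p.Rel)

theorem card_quotient_setoid (p : CornerPartition) :
    Nat.card (Quotient p.setoid) = p.numBlocks := by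
  rw [Nat.card_eq_fintype_card]
  revert p
  decide

theorem eq_of_rel_iff : ∀ {p q : CornerPartition}, (∀ i j, p.Rel i j ↔ q.Rel i j) → p = q := by
  decide

theorem setoid_surjective : Function.Surjective setoid := by
  intro s
  suffices ∃ p : CornerPartition, ∀ i j, p.Rel i j ↔ s i j from this.imp fun p hp => Setoid.ext hp
  have refl := s.refl'
  have symm (i j) : s i j → s j i := s.symm'
  have trans (i j k) : s i j → s j k → s i k := s.trans'
  by_cases hul : s .up .left <;> by_cases hur : s .up .right <;> by_cases hlr : s .left .right
  · exact ⟨joined, by simp only [Corner.forall, Rel]; grind⟩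
  · grind
  · grind
  · exact ⟨isolating .right, by simp only [Corner.forall, Rel]; grind⟩
  · grind
  · exact ⟨isolating .left, by simp only [Corner.forall, Rel]; grind⟩
  · exact ⟨isolating .up, by simp only [Corner.forall, Rel]; grind⟩
  · exact ⟨discrete, by simp only [Corner.forall, Rel]; grind⟩

end CornerPartition

namespace TriangleGraph

section RootedForests

variable {G : TriangleGraph} {F : Finset G.Edge} {k : ℕ}

theorem edgeSet_spanning (F : Finset G.Edge) :
    (spanning F).edgeSet = G.ends '' F \ Sym2.diagSet := by
  rw [spanning, SimpleGraph.edgeSet_fromEdgeSet]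

theorem isSpanningForest_iff_card [Finite G.verts] :
    IsSpanningForest k F ↔
      F.card + k = Nat.card G.verts ∧ Nat.card (spanning F).ConnectedComponent = k := by
  have hfin : (G.ends '' (F : Set G.Edge)).Finite := F.finite_toSet.image _
  have himage : (G.ends '' (F : Set G.Edge)).ncard ≤ F.card :=
    (Set.ncard_image_le F.finite_toSet).trans_eq (Set.ncard_coe_finset F)
  have hsub : (spanning F).edgeSet ⊆ G.ends '' F := edgeSet_spanning F ▸ Set.sdiff_subset
  have hedges := Set.ncard_le_ncard hsub hfin
  constructor
  · rintro ⟨hdiag, hinj, hacyclic, rfl⟩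
    refine ⟨?_, rfl⟩
    have hdisj : Disjoint (G.ends '' (F : Set G.Edge)) Sym2.diagSet := by
      rw [Set.disjoint_left]
      rintro _ ⟨e, he, rfl⟩
      exact hdiag e he
    rw [← isAcyclic_iff_ncard_edgeSet_add_card_connectedComponent.1 hacyclic, edgeSet_spanning,
      hdisj.sdiff_eq_left, hinj.ncard_image, Set.ncard_coe_finset]
  · rintro ⟨hcard, rfl⟩
    have hle := card_le_ncard_edgeSet_add_card_connectedComponent (spanning F)
    refine ⟨fun e he => ?_, ?_,
      isAcyclic_iff_ncard_edgeSet_add_card_connectedComponent.2 (by omega), rfl⟩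
    · have heq : (spanning F).edgeSet = G.ends '' F :=
        Set.eq_of_subset_of_ncard_le hsub (by omega) hfin
      have hmem : G.ends e ∈ (spanning F).edgeSet := heq ▸ Set.mem_image_of_mem _ he
      exact (spanning F).not_isDiag_of_mem_edgeSet hmem
    · refine Set.injOn_of_ncard_image_eq ?_ F.finite_toSet
      rw [Set.ncard_coe_finset]
      omega

/-- The component of the spanning subgraph that contains the outmost vertex `i`. -/
def outmostComponent (F : Finset G.Edge) (i : Corner) : (spanning F).ConnectedComponent :=
  (spanning F).connectedComponentMk (G.outmost i)

/-- The partition of the corners induced by the components of the outmost vertices. -/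
noncomputable def cornerPartition (F : Finset G.Edge) : CornerPartition :=
  (CornerPartition.setoid_surjective (Setoid.ker (outmostComponent F))).choose

theorem setoid_cornerPartition (F : Finset G.Edge) :
    (cornerPartition F).setoid = Setoid.ker (outmostComponent F) :=
  (CornerPartition.setoid_surjective _).choose_spec

theorem joined_iff {i j : Corner} : Joined F i j ↔ (cornerPartition F).Rel i j := by
  rw [Joined, ← SimpleGraph.ConnectedComponent.eq]
  exact (Setoid.ext_iff.1 (setoid_cornerPartition F) i j).symm

/-- Every vertex is joined to an outmost vertex. -/
def IsRooted (F : Finset G.Edge) : Prop :=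
  ∀ v, ∃ i, (spanning F).Reachable v (G.outmost i)

theorem isRooted_iff_range_outmostComponent :
    IsRooted F ↔ Set.range (outmostComponent F) = Set.univ := by
  rw [Set.range_eq_univ, Function.Surjective, SimpleGraph.ConnectedComponent.forall]
  exact forall_congr' fun v => exists_congr fun i =>
    ⟨fun h => (SimpleGraph.ConnectedComponent.sound h).symm,
      fun h => (SimpleGraph.ConnectedComponent.exact h).symm⟩

theorem ncard_range_outmostComponent (F : Finset G.Edge) :
    (Set.range (outmostComponent F)).ncard = (cornerPartition F).numBlocks := by
  rw [← Nat.card_coe_set_eq, ← Nat.card_congr (Setoid.quotientKerEquivRange _),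
    ← setoid_cornerPartition, CornerPartition.card_quotient_setoid]

theorem numBlocks_cornerPartition_le [Finite G.verts] (F : Finset G.Edge) :
    (cornerPartition F).numBlocks ≤ Nat.card (spanning F).ConnectedComponent := by
  rw [← ncard_range_outmostComponent]
  exact Set.ncard_le_card _

theorem isRooted_iff_card [Finite G.verts] :
    IsRooted F ↔ Nat.card (spanning F).ConnectedComponent = (cornerPartition F).numBlocks := by
  rw [isRooted_iff_range_outmostComponent, ← ncard_range_outmostComponent,
    Set.eq_univ_iff_ncard, eq_comm]

/-- A spanning forest each of whose components contains an outmost vertex. -/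
def IsRootedForest (F : Finset G.Edge) : Prop :=
  IsSpanningForest (cornerPartition F).numBlocks F

theorem isRootedForest_iff [Finite G.verts] :
    IsRootedForest F ↔
      F.card + (cornerPartition F).numBlocks = Nat.card G.verts ∧ IsRooted F := by
  rw [IsRootedForest, isSpanningForest_iff_card, isRooted_iff_card]

/-- The weighted generating function of the rooted forests that induce the partition `p` of the
corners: a common form of `treeGF`, `twoForestGF` and `threeForestGF`. -/
noncomputable def rootedForestGF {R : Type*} [CommSemiring R] (G : TriangleGraph) (w : Label → R)
    (p : CornerPartition) : R :=
  G.genFun w fun F => IsRootedForest F ∧ cornerPartition F = p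

variable {R : Type*} [CommSemiring R] (w : Label → R)

theorem treeGF_eq_rootedForestGF [Finite G.verts] :
    G.treeGF w = G.rootedForestGF w .joined := by
  have eq_joined : ∀ p : CornerPartition, p.numBlocks ≤ 1 → p = .joined := by decide
  unfold treeGF rootedForestGF
  congr! 2 with F
  refine ⟨fun hF => ?_, fun ⟨hF, hp⟩ => by rwa [IsRootedForest, hp] at hF⟩
  have hp := eq_joined _ ((numBlocks_cornerPartition_le F).trans_eq hF.2.2.2)
  exact ⟨by rwa [IsRootedForest, hp], hp⟩

theorem twoForestGF_eq_rootedForestGF (k : Corner) :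
    G.twoForestGF w k = G.rootedForestGF w (.isolating k) := by
  have iff_isolating : ∀ (p : CornerPartition) (k : Corner),
      (∀ i j, i ≠ k → j ≠ k → p.Rel i j ∧ ¬p.Rel i k) ↔ p = .isolating k := by decide
  unfold twoForestGF rootedForestGF
  congr! 2 with F
  simp only [joined_iff, iff_isolating]
  exact and_congr_left fun hp => by rw [IsRootedForest, hp, CornerPartition.numBlocks]

theorem threeForestGF_eq_rootedForestGF :
    G.threeForestGF w = G.rootedForestGF w .discrete := by
  have iff_discrete : ∀ p : CornerPartition, (∀ i j, i ≠ j → ¬p.Rel i j) ↔ p = .discrete := by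
    decide
  unfold threeForestGF rootedForestGF
  congr! 2 with F
  simp only [joined_iff, iff_discrete]
  exact and_congr_left fun hp => by rw [IsRootedForest, hp, CornerPartition.numBlocks]

end RootedForests

end TriangleGraph

theorem Corner.reflect_self : ∀ k : Corner, k.reflect k = k := by decide

theorem Corner.reflect_involutive : ∀ k : Corner, Function.Involutive k.reflect := by
  unfold Function.Involutive
  decide

namespace CornerPartition

/-- A corner of a copy in the glued graph is encoded as an element of `Sym2 Corner`: `s(k, k)` is
the outmost vertex `k`, and `s(k, l)` is the vertex shared by the copies at `k` and `l`. Thus the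
corners of the copy at `k` are the `s(k, i)`, and `s(k, i)` is the corner `k.reflect i` of the
unreflected graph. A set of these is closed for a choice `q` of corner partitions of the three
copies if it contains with a corner of a copy all the corners of the copy in the same block. -/
def IsClosed (q : Corner → CornerPartition) (S : Finset (Sym2 Corner)) : Prop :=
  ∀ k i j, (q k).Rel (k.reflect i) (k.reflect j) → s(k, i) ∈ S → s(k, j) ∈ S

/-- The corners `m` and `n` of copies are connected in the glued graph if the copies have the corner
partitions `q`. This is phrased as a universal property, which makes it decidable. -/
def NodesConnected (q : Corner → CornerPartition) (m n : Sym2 Corner) : Prop :=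
  ∀ S : Finset (Sym2 Corner), m ∈ S → IsClosed q S → n ∈ S

/-- Rooted forests with corner partitions `q` in the three copies unite to a rooted forest with
corner partition `p`. -/
def Glues (q : Corner → CornerPartition) (p : CornerPartition) : Prop :=
  ∑ k, (q k).numBlocks = p.numBlocks + 3 ∧
    (∀ i j, NodesConnected q s(i, i) s(j, j) ↔ p.Rel i j) ∧
      ∀ n, ∃ l, NodesConnected q n s(l, l)

instance (q : Corner → CornerPartition) : DecidablePred (IsClosed q) := fun S => by
  unfold IsClosed
  infer_instance

instance (q : Corner → CornerPartition) : DecidableRel (NodesConnected q) := fun m n => by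
  unfold NodesConnected
  infer_instance

instance (q : Corner → CornerPartition) : DecidablePred (Glues q) := fun p => by
  unfold Glues
  infer_instance

/-- The families of three corner partitions which glue to `p`, counted with multiplicity but
without recording which member of a family belongs to which copy. -/
def gluings (p : CornerPartition) : Multiset (Multiset CornerPartition) :=
  (Finset.univ.filter (Glues · p)).val.map fun q => Finset.univ.val.map q

theorem gluings_joined :
    gluings joined = 2 • {{joined, joined, isolating .up}, {joined, joined, isolating .right},
      {joined, joined, isolating .left}} := by
  decide +kernel

theorem gluings_isolating : ∀ {i j k : Corner}, i ≠ j → i ≠ k → j ≠ k →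
    gluings (isolating k) = 3 • {{joined, isolating i, isolating j}} +
      {{joined, isolating k, isolating j}, {joined, isolating k, isolating i}} +
      2 • {{joined, isolating k, isolating k}} + {{joined, joined, discrete}} := by
  decide +kernel

theorem gluings_discrete :
    gluings discrete = 4 • {{joined, discrete, isolating .up}, {joined, discrete, isolating .right},
        {joined, discrete, isolating .left}} +
      2 • {{isolating .up, isolating .up, isolating .left},
        {isolating .up, isolating .up, isolating .right},
        {isolating .right, isolating .right, isolating .up},
        {isolating .right, isolating .right, isolating .left},
        {isolating .left, isolating .left, isolating .right},
        {isolating .left, isolating .left, isolating .up}} +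
      2 • {{isolating .up, isolating .right, isolating .left}} := by
  decide +kernel

end CornerPartition

/-- The cyclic permutation of the corners. -/
def Corner.next : Corner → Corner
  | .up => .left
  | .left => .right
  | .right => .up

section Geometry

variable {N : ℕ} {k : Corner} {x : Point}

theorem Corner.sum_univ (x : Point) : ∑ i, x i = x .up + x .left + x .right := by
  simp [Finset.univ, Fintype.elems, add_assoc]

theorem sum_cornerPoint (N : ℕ) (k : Corner) : ∑ i, cornerPoint N k i = N :=
  Fintype.sum_pi_single' k N

theorem eq_cornerPoint_of_le (hx : ∑ i, x i = N) (hk : N ≤ x k) : x = cornerPoint N k := by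
  rw [Corner.sum_univ] at hx
  funext i
  cases k <;> cases i <;> simp [cornerPoint] <;> omega

theorem placeCopy_injective (N : ℕ) (k : Corner) : Function.Injective (placeCopy N k) := by
  intro x y hxy
  funext i
  have h := congrFun hxy (k.reflect i)
  rwa [placeCopy, placeCopy, k.reflect_involutive i, Nat.add_right_cancel_iff] at h

theorem sum_placeCopy (N : ℕ) (k : Corner) (x : Point) :
    ∑ i, placeCopy N k x i = ∑ i, x i + N := by
  simp only [placeCopy, Finset.sum_add_distrib, sum_cornerPoint]
  rw [k.reflect_involutive.bijective.sum_comp x]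

theorem placeCopy_cornerPoint (N : ℕ) (k l : Corner) :
    placeCopy N k (cornerPoint N (k.reflect l)) = cornerPoint N l + cornerPoint N k := by
  funext i
  simp only [placeCopy, cornerPoint, Pi.add_apply, Pi.single_apply,
    k.reflect_involutive.injective.eq_iff]

end Geometry

namespace TriangleGraph

section Inscribed

variable {G : TriangleGraph} {k l : Corner} {x y : G.verts}

/-- The vertices of `G` are lattice points of the triangle of side length `G.side > 0`, and the
outmost vertices are its corners. -/
structure IsInscribed (G : TriangleGraph) : Prop where
  side_pos : 0 < G.side
  finite : Finite G.verts
  sum_eq : ∀ x ∈ G.verts, ∑ i, x i = G.side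
  outmost_eq : ∀ k, (G.outmost k : Point) = cornerPoint G.side k

theorem isInscribed_triangle : triangle.IsInscribed where
  side_pos := Nat.one_pos
  finite := Set.finite_range _
  sum_eq := Set.forall_mem_range.2 (sum_cornerPoint 1)
  outmost_eq _ := rfl

/-- `copyVert` with values in the vertices of the glued graph. -/
def toGlue (G : TriangleGraph) (k : Corner) (x : G.verts) : G.glue.verts := G.copyVert k x

theorem coe_toGlue (k : Corner) (x : G.verts) :
    (G.toGlue k x : Point) = placeCopy G.side k x := rfl

theorem toGlue_injective (k : Corner) : Function.Injective (G.toGlue k) := fun _ _ h =>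
  Subtype.ext (placeCopy_injective _ _ (congrArg Subtype.val h))

theorem exists_toGlue_eq (v : G.glue.verts) : ∃ k x, G.toGlue k x = v := by
  obtain ⟨v, hv⟩ := v
  obtain ⟨k, x, hx, rfl⟩ := Set.mem_iUnion.1 hv
  exact ⟨k, ⟨x, hx⟩, rfl⟩

theorem outmost_glue (k : Corner) : G.glue.outmost k = G.toGlue k (G.outmost k) := rfl

namespace IsInscribed

theorem outmost_injective (hG : G.IsInscribed) : Function.Injective G.outmost := by
  intro i j hij
  have h := congrFun (congrArg Subtype.val hij) i
  rw [hG.outmost_eq, hG.outmost_eq, cornerPoint, cornerPoint, Pi.single_eq_same] at h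
  by_contra hne
  exact hG.side_pos.ne' (h.trans (Pi.single_eq_of_ne hne _))

theorem coe_toGlue_outmost (hG : G.IsInscribed) (k l : Corner) :
    (G.toGlue k (G.outmost (k.reflect l)) : Point) =
      cornerPoint G.side l + cornerPoint G.side k := by
  rw [coe_toGlue, hG.outmost_eq, placeCopy_cornerPoint]

theorem toGlue_outmost_comm (hG : G.IsInscribed) (k l : Corner) :
    G.toGlue k (G.outmost (k.reflect l)) = G.toGlue l (G.outmost (l.reflect k)) :=
  Subtype.ext (by rw [hG.coe_toGlue_outmost, hG.coe_toGlue_outmost, add_comm])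

theorem eq_outmost_of_toGlue_eq (hG : G.IsInscribed) (hkl : k ≠ l)
    (hxy : G.toGlue k x = G.toGlue l y) : x = G.outmost (k.reflect l) := by
  have h := congrFun (congrArg Subtype.val hxy) l
  simp only [coe_toGlue, placeCopy, cornerPoint, Pi.single_eq_of_ne hkl.symm,
    Pi.single_eq_same] at h
  apply Subtype.ext
  rw [hG.outmost_eq]
  exact eq_cornerPoint_of_le (hG.sum_eq x x.2) (by omega)

theorem glue (hG : G.IsInscribed) : G.glue.IsInscribed where
  side_pos := Nat.mul_pos two_pos hG.side_pos
  finite := Set.finite_iUnion fun k => (show G.verts.Finite from hG.finite).image _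
  sum_eq := by
    intro v hv
    obtain ⟨k, x, hx, rfl⟩ := Set.mem_iUnion.1 hv
    rw [sum_placeCopy, hG.sum_eq x hx, ← two_mul]
    rfl
  outmost_eq k := by
    have h := hG.coe_toGlue_outmost k k
    rw [Corner.reflect_self] at h
    rw [outmost_glue, h, cornerPoint, cornerPoint, ← Pi.single_add, ← two_mul]
    rfl

/-- The vertex of the glued graph encoded by an element of `Sym2 Corner`. -/
def node (hG : G.IsInscribed) : Sym2 Corner → G.glue.verts :=
  Sym2.lift ⟨fun k i => G.toGlue k (G.outmost (k.reflect i)), hG.toGlue_outmost_comm⟩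

theorem node_mk (hG : G.IsInscribed) (k i : Corner) :
    hG.node s(k, i) = G.toGlue k (G.outmost (k.reflect i)) := rfl

theorem outmost_glue_eq_node (hG : G.IsInscribed) (k : Corner) :
    G.glue.outmost k = hG.node s(k, k) := by
  rw [node_mk, Corner.reflect_self, outmost_glue]

theorem card_glue_verts (hG : G.IsInscribed) :
    Nat.card G.glue.verts + 3 = 3 * Nat.card G.verts := by
  have := hG.finite
  have next_next_ne : ∀ k : Corner, k.next.next ≠ k := by decide
  have eq_next : ∀ k l : Corner, k ≠ l → l = k.next ∨ k = l.next := by decide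
  let dup (k : Corner) : Corner × G.verts := (k, G.outmost (k.reflect k.next))
  let f (v : ↥(Set.range dup)ᶜ) : G.glue.verts := G.toGlue v.1.1 v.1.2
  have hf : Function.Bijective f := by
    constructor
    · rintro ⟨⟨k, x⟩, hx⟩ ⟨⟨l, y⟩, hy⟩ hxy
      by_cases hkl : k = l
      · subst hkl
        obtain rfl := toGlue_injective k hxy
        rfl
      · rcases eq_next k l hkl with rfl | rfl
        · obtain rfl := hG.eq_outmost_of_toGlue_eq hkl hxy
          exact absurd ⟨k, rfl⟩ hx
        · obtain rfl := hG.eq_outmost_of_toGlue_eq (Ne.symm hkl) hxy.symm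
          exact absurd ⟨l, rfl⟩ hy
    · intro v
      obtain ⟨k, x, rfl⟩ := exists_toGlue_eq v
      by_cases hx : (k, x) ∈ Set.range dup
      · obtain ⟨k, rfl, rfl⟩ := hx
        refine ⟨⟨(k.next, G.outmost (k.next.reflect k)), ?_⟩, hG.toGlue_outmost_comm _ _⟩
        rintro ⟨l, hl⟩
        obtain ⟨rfl, hl⟩ := Prod.ext_iff.1 hl
        exact next_next_ne k (k.next.reflect_involutive.injective (hG.outmost_injective hl))
      · exact ⟨⟨(k, x), hx⟩, rfl⟩
  have hdup : (Set.range dup).ncard = 3 := by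
    rw [← Set.image_univ, Set.ncard_image_of_injective _ fun k l h => congrArg Prod.fst h,
      Set.ncard_univ, Nat.card_eq_fintype_card]
    rfl
  have h := Set.ncard_add_ncard_compl (Set.range dup)
  rw [hdup, ← Nat.card_coe_set_eq, Nat.card_eq_of_bijective f hf, Nat.card_prod,
    Nat.card_eq_fintype_card (α := Corner)] at h
  rw [add_comm, h]
  rfl

end IsInscribed

end Inscribed

section Gluing

variable {G : TriangleGraph} {H : Corner → Finset G.Edge} {k l : Corner} {x y : G.verts}

/-- The edges of the glued graph as edges of copies. -/
def glueEdge (G : TriangleGraph) : (Σ _ : Corner, G.Edge) ≃ G.glue.Edge :=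
  Equiv.sigmaEquivProd Corner G.Edge

theorem ends_glueEdge (k : Corner) (e : G.Edge) :
    G.glue.ends (G.glueEdge ⟨k, e⟩) = (G.ends e).map (G.toGlue k) := rfl

/-- The edge set of the glued graph whose part in the copy at the corner `k` is `H k`. -/
def assemble (H : Corner → Finset G.Edge) : Finset G.glue.Edge :=
  (Finset.univ.sigma H).map G.glueEdge.toEmbedding

theorem mem_assemble {e : G.Edge} : G.glueEdge ⟨k, e⟩ ∈ assemble H ↔ e ∈ H k := by
  simp [assemble]

theorem assemble_bijective : Function.Bijective (assemble (G := G)) := by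
  classical
  refine ⟨fun H K hHK => ?_, fun F => ⟨fun k => {e | G.glueEdge ⟨k, e⟩ ∈ F}, ?_⟩⟩
  · funext k
    ext e
    rw [← mem_assemble, hHK, mem_assemble]
  · ext e
    obtain ⟨⟨k, e⟩, rfl⟩ := G.glueEdge.surjective e
    simp only [mem_assemble, Finset.mem_filter_univ]

theorem card_assemble (H : Corner → Finset G.Edge) : (assemble H).card = ∑ k, (H k).card := by
  rw [assemble, Finset.card_map, Finset.card_sigma]

theorem weight_assemble {R : Type*} [CommSemiring R] (w : Label → R)
    (H : Corner → Finset G.Edge) : weight w (assemble H) = ∏ k, weight w (H k) := by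
  rw [weight, assemble, Finset.prod_map, Finset.prod_sigma]
  rfl

theorem spanning_adj {F : Finset G.Edge} :
    (spanning F).Adj x y ↔ (∃ e ∈ F, G.ends e = s(x, y)) ∧ x ≠ y :=
  SimpleGraph.fromEdgeSet_adj _

theorem spanning_assemble_adj {v v' : G.glue.verts} :
    (spanning (assemble H)).Adj v v' ↔
      ∃ k x x', (spanning (H k)).Adj x x' ∧ G.toGlue k x = v ∧ G.toGlue k x' = v' := by
  simp only [spanning_adj]
  constructor
  · rintro ⟨⟨e, he, hv⟩, hne⟩
    obtain ⟨⟨k, e⟩, rfl⟩ := G.glueEdge.surjective e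
    rw [mem_assemble] at he
    rw [ends_glueEdge] at hv
    obtain ⟨x, ⟨x', hends⟩, rfl⟩ := Sym2.mem_map.1 (hv ▸ Sym2.mem_mk_left v v')
    rw [hends, Sym2.map_mk, Sym2.congr_right] at hv
    subst hv
    exact ⟨k, x, x', ⟨⟨e, he, hends⟩, ne_of_apply_ne _ hne⟩, rfl, rfl⟩
  · rintro ⟨k, x, x', ⟨⟨e, he, hends⟩, hne⟩, rfl, rfl⟩
    refine ⟨⟨G.glueEdge ⟨k, e⟩, mem_assemble.2 he, ?_⟩, (toGlue_injective k).ne hne⟩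
    rw [ends_glueEdge, hends, Sym2.map_mk]

/-- `toGlue` as a graph homomorphism. -/
def toGlueHom (H : Corner → Finset G.Edge) (k : Corner) :
    spanning (H k) →g spanning (assemble H) where
  toFun := G.toGlue k
  map_rel' hadj := spanning_assemble_adj.2 ⟨k, _, _, hadj, rfl, rfl⟩

theorem reachable_toGlue (h : (spanning (H k)).Reachable x y) :
    (spanning (assemble H)).Reachable (G.toGlue k x) (G.toGlue k y) :=
  h.map (toGlueHom H k)

theorem isSpanningForest_of_assemble {n : ℕ} (hH : IsSpanningForest n (assemble H)) (k : Corner) :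
    IsSpanningForest (Nat.card (spanning (H k)).ConnectedComponent) (H k) := by
  obtain ⟨hdiag, hinj, hacyclic, -⟩ := hH
  refine ⟨fun e he hd => hdiag _ (mem_assemble.2 he) ?_, fun e he e' he' hee' => ?_,
    hacyclic.comap (toGlueHom H k) (toGlue_injective k), rfl⟩
  · rwa [ends_glueEdge, Sym2.isDiag_map (toGlue_injective k)]
  · have h := hinj (mem_assemble.2 he) (mem_assemble.2 he')
      (by rw [ends_glueEdge, ends_glueEdge, hee'])
    simpa using h

/-- The vertex `x` of the copy at the corner `k` is joined, inside that copy, to a corner of the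
copy which belongs to `S`. -/
def ReachesNode (H : Corner → Finset G.Edge) (S : Finset (Sym2 Corner)) (k : Corner)
    (x : G.verts) : Prop :=
  ∃ i, (spanning (H k)).Reachable x (G.outmost (k.reflect i)) ∧ s(k, i) ∈ S

open CornerPartition

variable {S : Finset (Sym2 Corner)} {m n : Sym2 Corner}

theorem reachesNode_outmost_iff (hS : IsClosed (fun k => cornerPartition (H k)) S) (i : Corner) :
    ReachesNode H S k (G.outmost (k.reflect i)) ↔ s(k, i) ∈ S :=
  ⟨fun ⟨j, hij, hj⟩ => hS k j i (joined_iff.1 hij.symm) hj, fun hi => ⟨i, .rfl, hi⟩⟩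

theorem reachesNode_congr (h : (spanning (H k)).Reachable x y) :
    ReachesNode H S k x ↔ ReachesNode H S k y :=
  exists_congr fun _ => and_congr_left fun _ => ⟨h.symm.trans, h.trans⟩

namespace IsInscribed

theorem reachesNode_iff_of_toGlue_eq (hG : G.IsInscribed)
    (hS : IsClosed (fun k => cornerPartition (H k)) S) (hxy : G.toGlue k x = G.toGlue l y) :
    ReachesNode H S k x ↔ ReachesNode H S l y := by
  by_cases hkl : k = l
  · subst hkl
    rw [toGlue_injective k hxy]
  · rw [hG.eq_outmost_of_toGlue_eq hkl hxy, hG.eq_outmost_of_toGlue_eq (Ne.symm hkl) hxy.symm,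
      reachesNode_outmost_iff hS, reachesNode_outmost_iff hS, Sym2.eq_swap]

theorem reachesNode_iff_of_reachable (hG : G.IsInscribed)
    (hS : IsClosed (fun k => cornerPartition (H k)) S)
    (hxy : (spanning (assemble H)).Reachable (G.toGlue k x) (G.toGlue l y)) :
    ReachesNode H S k x ↔ ReachesNode H S l y := by
  let Good (v : G.glue.verts) : Prop := ∃ k x, G.toGlue k x = v ∧ ReachesNode H S k x
  have good_toGlue (k : Corner) (x : G.verts) : Good (G.toGlue k x) ↔ ReachesNode H S k x :=
    ⟨fun ⟨_, _, hv, hx⟩ => (hG.reachesNode_iff_of_toGlue_eq hS hv).1 hx, fun hx => ⟨k, x, rfl, hx⟩⟩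
  have good_of_adj (v v' : G.glue.verts) (hv : (spanning (assemble H)).Adj v v') :
      Good v = Good v' := by
    obtain ⟨k, x, x', hadj, rfl, rfl⟩ := spanning_assemble_adj.1 hv
    rw [good_toGlue, good_toGlue, reachesNode_congr hadj.reachable]
  rw [← good_toGlue, ← good_toGlue, eq_of_reachable good_of_adj hxy]

theorem reachable_node_iff (hG : G.IsInscribed) :
    (spanning (assemble H)).Reachable (hG.node m) (hG.node n) ↔
      NodesConnected (fun k => cornerPartition (H k)) m n := by
  constructor
  · induction m with | _ k i
    induction n with | _ l j
    intro h S hm hS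
    rw [← reachesNode_outmost_iff hS] at hm ⊢
    exact (hG.reachesNode_iff_of_reachable hS h).1 hm
  · classical
    intro h
    let S : Finset (Sym2 Corner) :=
      {n | (spanning (assemble H)).Reachable (hG.node m) (hG.node n)}
    have hS : IsClosed (fun k => cornerPartition (H k)) S := by
      intro k i j hij hi
      rw [Finset.mem_filter_univ] at hi ⊢
      exact hi.trans (reachable_toGlue (joined_iff.2 hij))
    exact (Finset.mem_filter_univ n).1 (h S ((Finset.mem_filter_univ m).2 .rfl) hS)

theorem cornerPartition_assemble_eq_iff (hG : G.IsInscribed) {p : CornerPartition} :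
    cornerPartition (assemble H) = p ↔
      ∀ i j, NodesConnected (fun k => cornerPartition (H k)) s(i, i) s(j, j) ↔ p.Rel i j := by
  have joined (i j : Corner) : (cornerPartition (assemble H)).Rel i j ↔
      NodesConnected (fun k => cornerPartition (H k)) s(i, i) s(j, j) := by
    rw [← joined_iff, Joined, hG.outmost_glue_eq_node, hG.outmost_glue_eq_node,
      hG.reachable_node_iff]
  simp only [← joined]
  exact ⟨fun h => by simp only [h, implies_true], eq_of_rel_iff⟩

theorem isRooted_assemble_iff (hG : G.IsInscribed) :
    IsRooted (assemble H) ↔ (∀ k, IsRooted (H k)) ∧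
      ∀ n, ∃ l, NodesConnected (fun k => cornerPartition (H k)) n s(l, l) := by
  simp only [← hG.reachable_node_iff, ← hG.outmost_glue_eq_node]
  refine ⟨fun h => ⟨fun k x => ?_, fun n => h (hG.node n)⟩, fun ⟨hH, hnode⟩ v => ?_⟩
  · obtain ⟨l, hl⟩ := h (G.toGlue k x)
    have huniv : IsClosed (fun k => cornerPartition (H k)) Finset.univ :=
      fun _ _ _ _ _ => Finset.mem_univ _
    have hl' : ReachesNode H Finset.univ l (G.outmost l) :=
      ⟨l, by rw [Corner.reflect_self], Finset.mem_univ _⟩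
    obtain ⟨i, hi, -⟩ := (hG.reachesNode_iff_of_reachable huniv hl).2 hl'
    exact ⟨_, hi⟩
  · obtain ⟨k, x, rfl⟩ := exists_toGlue_eq v
    obtain ⟨i, hi⟩ := hH k x
    obtain ⟨l, hl⟩ := hnode s(k, k.reflect i)
    rw [node_mk, k.reflect_involutive] at hl
    exact ⟨l, (reachable_toGlue hi).trans hl⟩

theorem isRootedForest_assemble_iff (hG : G.IsInscribed) {p : CornerPartition} :
    IsRootedForest (assemble H) ∧ cornerPartition (assemble H) = p ↔
      (∀ k, IsRootedForest (H k)) ∧ Glues (fun k => cornerPartition (H k)) p := by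
  have := hG.finite
  have := hG.glue.finite
  have hverts := hG.card_glue_verts
  have hsum (hcard : ∀ k, (H k).card + (cornerPartition (H k)).numBlocks = Nat.card G.verts) :
      (assemble H).card + ∑ k, (cornerPartition (H k)).numBlocks = Nat.card G.glue.verts + 3 := by
    rw [card_assemble, ← Finset.sum_add_distrib, hverts]
    simp only [hcard, Finset.sum_const, smul_eq_mul]
    rfl
  rw [Glues, ← hG.cornerPartition_assemble_eq_iff]
  constructor
  · rintro ⟨hforest, rfl⟩
    obtain ⟨hcard, hrooted⟩ := isRootedForest_iff.1 hforest
    obtain ⟨hroots, hnode⟩ := hG.isRooted_assemble_iff.1 hrooted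
    have hH (k : Corner) : IsRootedForest (H k) := by
      rw [IsRootedForest, ← isRooted_iff_card.1 (hroots k)]
      exact isSpanningForest_of_assemble hforest k
    have := hsum fun k => (isRootedForest_iff.1 (hH k)).1
    exact ⟨hH, by omega, rfl, hnode⟩
  · rintro ⟨hH, hblocks, rfl, hnode⟩
    have := hsum fun k => (isRootedForest_iff.1 (hH k)).1
    refine ⟨isRootedForest_iff.2 ⟨by omega, hG.isRooted_assemble_iff.2 ⟨fun k => ?_, hnode⟩⟩, rfl⟩
    exact (isRootedForest_iff.1 (hH k)).2

variable {R : Type*} [CommSemiring R] (w : Label → R)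

theorem rootedForestGF_glue (hG : G.IsInscribed) (p : CornerPartition) :
    G.glue.rootedForestGF w p =
      ((gluings p).map fun s => (s.map (G.rootedForestGF w)).prod).sum := by
  classical
  have hmaps : ∀ H ∈ ({H | (∀ k, IsRootedForest (H k)) ∧ Glues (fun k => cornerPartition (H k)) p} :
      Finset (Corner → Finset G.Edge)), (fun k => cornerPartition (H k)) ∈
        ({q | Glues q p} : Finset (Corner → CornerPartition)) := by
    simp +contextual
  calc G.glue.rootedForestGF w p
    _ = ∑ H : Corner → Finset G.Edge with
          (∀ k, IsRootedForest (H k)) ∧ Glues (fun k => cornerPartition (H k)) p,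
          ∏ k, weight w (H k) := by
      simp only [rootedForestGF, genFun, Finset.sum_filter, ← hG.isRootedForest_assemble_iff,
        ← assemble_bijective.sum_comp, weight_assemble]
    _ = ∑ q : Corner → CornerPartition with Glues q p, ∏ k, G.rootedForestGF w (q k) := by
      rw [← Finset.sum_fiberwise_of_maps_to hmaps]
      refine Finset.sum_congr rfl fun q hq => ?_
      simp only [rootedForestGF, genFun, Finset.prod_univ_sum]
      refine Finset.sum_congr ?_ fun _ _ => rfl
      ext H
      rw [Finset.mem_filter_univ] at hq
      simp only [Finset.mem_filter, Finset.mem_univ, true_and, Fintype.mem_piFinset, forall_and,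
        ← funext_iff]
      exact ⟨fun ⟨⟨hH, _⟩, hHq⟩ => ⟨hH, hHq⟩, fun ⟨hH, hHq⟩ => ⟨⟨hH, hHq ▸ hq⟩, hHq⟩⟩
    _ = ((gluings p).map fun s => (s.map (G.rootedForestGF w)).prod).sum := by
      simp only [gluings, Multiset.map_map, Function.comp_def]
      rfl

end IsInscribed

end Gluing

section Triangle

open CornerPartition

/-- The label of the edge of the elementary triangle which avoids the corner `k`. -/
def oppositeSide : Corner → triangle.Edge
  | .up => Label.b
  | .left => Label.c
  | .right => Label.a

variable {F : Finset triangle.Edge} {p q : CornerPartition}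

theorem oppositeSide_surjective : Function.Surjective oppositeSide
  | .a => ⟨.right, rfl⟩
  | .b => ⟨.up, rfl⟩
  | .c => ⟨.left, rfl⟩

theorem ends_oppositeSide (k : Corner) :
    triangle.ends (oppositeSide k) = s(triangle.outmost k.next, triangle.outmost k.next.next) := by
  cases k <;> first | rfl | exact Sym2.eq_swap

theorem outmost_triangle_bijective : Function.Bijective triangle.outmost :=
  ⟨isInscribed_triangle.outmost_injective, fun ⟨_, k, hk⟩ => ⟨k, Subtype.ext hk⟩⟩

theorem joined_of_oppositeSide_mem {k : Corner} (hk : oppositeSide k ∈ F) :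
    Joined F k.next k.next.next := by
  have next_ne : ∀ i : Corner, i ≠ i.next := by decide
  exact (spanning_adj.2 ⟨⟨_, hk, ends_oppositeSide k⟩,
    outmost_triangle_bijective.injective.ne (next_ne _)⟩).reachable

theorem cornerPartition_triangle_le_iff :
    (∀ i j, (cornerPartition F).Rel i j → q.Rel i j) ↔
      ∀ k, oppositeSide k ∈ F → q.Rel k.next k.next.next := by
  refine ⟨fun h k hk => h _ _ (joined_iff.1 (joined_of_oppositeSide_mem hk)), fun h i j hij => ?_⟩
  let e := Equiv.ofBijective triangle.outmost outmost_triangle_bijective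
  let block (v : triangle.verts) : Quotient q.setoid := Quotient.mk _ (e.symm v)
  have block_outmost (i : Corner) : block (triangle.outmost i) = Quotient.mk _ i :=
    congrArg _ (e.symm_apply_apply i)
  have block_eq_of_adj (v v') (hadj : (spanning F).Adj v v') : block v = block v' := by
    obtain ⟨⟨l, hl, hends⟩, -⟩ := spanning_adj.1 hadj
    obtain ⟨k, rfl⟩ := oppositeSide_surjective l
    have hblock : block (triangle.outmost k.next) = block (triangle.outmost k.next.next) := by
      rw [block_outmost, block_outmost]
      exact Quotient.sound (h k hl)
    rw [ends_oppositeSide] at hends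
    rcases Sym2.eq_iff.1 hends with ⟨rfl, rfl⟩ | ⟨rfl, rfl⟩
    exacts [hblock, hblock.symm]
  have hblock := eq_of_reachable block_eq_of_adj (joined_iff.2 hij)
  rw [block_outmost, block_outmost] at hblock
  exact Quotient.exact hblock

theorem cornerPartition_triangle_eq_iff :
    cornerPartition F = p ↔ ∀ q : CornerPartition, (∀ i j, p.Rel i j → q.Rel i j) ↔
      ∀ k, oppositeSide k ∈ F → q.Rel k.next k.next.next := by
  simp only [← cornerPartition_triangle_le_iff]
  refine ⟨fun h q => by rw [h], fun h => eq_of_rel_iff fun i j => ⟨?_, ?_⟩⟩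
  · exact (h p).1 (fun _ _ => id) i j
  · exact (h (cornerPartition F)).2 (fun _ _ => id) i j

instance : DecidableEq triangle.Edge := inferInstanceAs (DecidableEq Label)

/-- The rooted forests of the elementary triangle with corner partition `p`. -/
def triangleForests : CornerPartition → Finset (Finset triangle.Edge)
  | joined => {{Label.a, Label.b}, {Label.a, Label.c}, {Label.b, Label.c}}
  | isolating k => {{oppositeSide k}}
  | discrete => {∅}

theorem isRootedForest_triangle_iff :
    IsRootedForest F ∧ cornerPartition F = p ↔ F ∈ triangleForests p := by
  have := isInscribed_triangle.finite
  have hrooted : IsRooted F := outmost_triangle_bijective.surjective.forall.2 fun i => ⟨i, .rfl⟩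
  have hcard : Nat.card triangle.verts = 3 :=
    (Nat.card_eq_of_bijective _ outmost_triangle_bijective).symm.trans
      Nat.card_eq_fintype_card
  have enumeration : ∀ (F : Finset triangle.Edge) (p : CornerPartition),
      F.card + p.numBlocks = 3 ∧ (∀ q : CornerPartition, (∀ i j, p.Rel i j → q.Rel i j) ↔
        ∀ k, oppositeSide k ∈ F → q.Rel k.next k.next.next) ↔ F ∈ triangleForests p := by
    decide +kernel
  rw [← enumeration, ← cornerPartition_triangle_eq_iff, isRootedForest_iff, hcard]
  constructor
  · rintro ⟨⟨h, -⟩, rfl⟩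
    exact ⟨h, rfl⟩
  · rintro ⟨h, rfl⟩
    exact ⟨⟨h, hrooted⟩, rfl⟩

variable {R : Type*} [CommSemiring R] (w : Label → R)

theorem rootedForestGF_triangle (p : CornerPartition) :
    triangle.rootedForestGF w p = ∑ F ∈ triangleForests p, weight w F := by
  classical
  simp only [rootedForestGF, genFun, isRootedForest_triangle_iff, Finset.sum_filter,
    Finset.sum_ite_mem, Finset.univ_inter]

theorem treeGF_triangle :
    triangle.treeGF w = w .a * w .b + w .a * w .c + w .b * w .c := by
  have := isInscribed_triangle.finite
  have weight_pair (e f : Label) (hef : e ≠ f) :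
      weight (G := triangle) w {e, f} = w e * w f := Finset.prod_pair hef
  rw [treeGF_eq_rootedForestGF, rootedForestGF_triangle, triangleForests,
    Finset.sum_insert (by decide), Finset.sum_pair (by decide), weight_pair _ _ (by decide),
    weight_pair _ _ (by decide), weight_pair _ _ (by decide), add_assoc]

theorem twoForestGF_triangle (k : Corner) :
    triangle.twoForestGF w k = w (triangle.label (oppositeSide k)) := by
  rw [twoForestGF_eq_rootedForestGF, rootedForestGF_triangle, triangleForests,
    Finset.sum_singleton, weight, Finset.prod_singleton]

theorem threeForestGF_triangle : triangle.threeForestGF w = 1 := by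
  rw [threeForestGF_eq_rootedForestGF, rootedForestGF_triangle, triangleForests,
    Finset.sum_singleton, weight, Finset.prod_empty]

end Triangle

end TriangleGraph

namespace TriangleGraph.IsInscribed

open CornerPartition

variable {G : TriangleGraph} {R : Type*} [CommSemiring R] (w : Label → R)

theorem treeGF_glue (hG : G.IsInscribed) :
    G.glue.treeGF w = 2 * G.treeGF w ^ 2 *
      (G.twoForestGF w .up + G.twoForestGF w .right + G.twoForestGF w .left) := by
  have := hG.finite
  have := hG.glue.finite
  simp only [treeGF_eq_rootedForestGF, twoForestGF_eq_rootedForestGF, hG.rootedForestGF_glue,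
    gluings_joined]
  simp only [Multiset.insert_eq_cons, Multiset.map_nsmul, Multiset.map_cons,
    Multiset.map_singleton, Multiset.prod_cons, Multiset.prod_singleton, Multiset.sum_nsmul,
    Multiset.sum_cons, Multiset.sum_singleton, nsmul_eq_mul, Nat.cast_ofNat]
  ring

theorem twoForestGF_glue (hG : G.IsInscribed) {i j k : Corner} (hij : i ≠ j) (hik : i ≠ k)
    (hjk : j ≠ k) :
    G.glue.twoForestGF w k =
      G.treeGF w * (3 * G.twoForestGF w i * G.twoForestGF w j +
        G.twoForestGF w k * G.twoForestGF w j + G.twoForestGF w k * G.twoForestGF w i +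
          2 * G.twoForestGF w k ^ 2) + G.treeGF w ^ 2 * G.threeForestGF w := by
  have := hG.finite
  simp only [treeGF_eq_rootedForestGF, twoForestGF_eq_rootedForestGF,
    threeForestGF_eq_rootedForestGF, hG.rootedForestGF_glue, gluings_isolating hij hik hjk]
  simp only [Multiset.insert_eq_cons, Multiset.map_nsmul, Multiset.map_add, Multiset.map_cons,
    Multiset.map_singleton, Multiset.prod_cons, Multiset.prod_singleton, Multiset.sum_nsmul,
    Multiset.sum_add, Multiset.sum_cons, Multiset.sum_singleton, nsmul_eq_mul, Nat.cast_ofNat]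
  ring

theorem threeForestGF_glue (hG : G.IsInscribed) :
    G.glue.threeForestGF w =
      4 * G.treeGF w * G.threeForestGF w *
          (G.twoForestGF w .up + G.twoForestGF w .right + G.twoForestGF w .left) +
        2 * (G.twoForestGF w .up ^ 2 * (G.twoForestGF w .left + G.twoForestGF w .right) +
            G.twoForestGF w .right ^ 2 * (G.twoForestGF w .up + G.twoForestGF w .left) +
            G.twoForestGF w .left ^ 2 * (G.twoForestGF w .right + G.twoForestGF w .up)) +
        2 * G.twoForestGF w .up * G.twoForestGF w .right * G.twoForestGF w .left := by
  have := hG.finite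
  simp only [treeGF_eq_rootedForestGF, twoForestGF_eq_rootedForestGF,
    threeForestGF_eq_rootedForestGF, hG.rootedForestGF_glue, gluings_discrete]
  simp only [Multiset.insert_eq_cons, Multiset.map_nsmul, Multiset.map_add, Multiset.map_cons,
    Multiset.map_singleton, Multiset.prod_cons, Multiset.prod_singleton, Multiset.sum_nsmul,
    Multiset.sum_add, Multiset.sum_cons, Multiset.sum_singleton, nsmul_eq_mul, Nat.cast_ofNat]
  ring

end TriangleGraph.IsInscribed

theorem schreierGraph_succ {n : ℕ} (hn : 1 ≤ n) :
    schreierGraph (n + 1) = (schreierGraph n).glue := by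
  obtain ⟨n, rfl⟩ := Nat.exists_eq_add_of_le' hn
  exact Function.iterate_succ_apply' _ _ _

theorem isInscribed_schreierGraph (n : ℕ) : (schreierGraph n).IsInscribed := by
  unfold schreierGraph
  induction n - 1 with
  | zero => exact TriangleGraph.isInscribed_triangle
  | succ n ih =>
    rw [Function.iterate_succ_apply']
    exact ih.glue

theorem mainTheorem11 {A : Type*} [CommSemiring A] (a b c : A) :
    (∀ n : ℕ, 1 ≤ n →
      schreierT (n + 1) a b c = 2 * schreierT n a b c ^ 2 *
        (schreierU n a b c + schreierR n a b c + schreierL n a b c) ∧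
      schreierU (n + 1) a b c =
        schreierT n a b c *
          (3 * schreierL n a b c * schreierR n a b c + schreierU n a b c * schreierR n a b c +
            schreierU n a b c * schreierL n a b c + 2 * schreierU n a b c ^ 2) +
        schreierT n a b c ^ 2 * schreierQ n a b c ∧
      schreierR (n + 1) a b c =
        schreierT n a b c *
          (3 * schreierU n a b c * schreierL n a b c + schreierR n a b c * schreierL n a b c +
            schreierR n a b c * schreierU n a b c + 2 * schreierR n a b c ^ 2) +
        schreierT n a b c ^ 2 * schreierQ n a b c ∧
      schreierL (n + 1) a b c =
        schreierT n a b c *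
          (3 * schreierU n a b c * schreierR n a b c + schreierL n a b c * schreierR n a b c +
            schreierL n a b c * schreierU n a b c + 2 * schreierL n a b c ^ 2) +
        schreierT n a b c ^ 2 * schreierQ n a b c ∧
      schreierQ (n + 1) a b c =
        4 * schreierT n a b c * schreierQ n a b c * (schreierU n a b c + schreierR n a b c + schreierL n a b c) +
        2 * (schreierU n a b c ^ 2 * (schreierL n a b c + schreierR n a b c) +
            schreierR n a b c ^ 2 * (schreierU n a b c + schreierL n a b c) +
            schreierL n a b c ^ 2 * (schreierR n a b c + schreierU n a b c)) +
        2 * schreierU n a b c * schreierR n a b c * schreierL n a b c) ∧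
    schreierT 1 a b c = a * b + a * c + b * c ∧
    schreierU 1 a b c = b ∧ schreierR 1 a b c = a ∧ schreierL 1 a b c = c ∧
    schreierQ 1 a b c = 1 := by
  refine ⟨fun n hn => ?_, TriangleGraph.treeGF_triangle _, TriangleGraph.twoForestGF_triangle _ .up,
    TriangleGraph.twoForestGF_triangle _ .right, TriangleGraph.twoForestGF_triangle _ .left,
    TriangleGraph.threeForestGF_triangle _⟩
  have hG := isInscribed_schreierGraph n
  simp only [schreierT, schreierU, schreierR, schreierL, schreierQ, schreierGraph_succ hn]
  exact ⟨hG.treeGF_glue _, hG.twoForestGF_glue _ (by decide) (by decide) (by decide),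
    hG.twoForestGF_glue _ (by decide) (by decide) (by decide),
    hG.twoForestGF_glue _ (by decide) (by decide) (by decide), hG.threeForestGF_glue _⟩
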